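/- Let $G=(V,E)$ be a finite simple graph and $d\ge 1$. For a map $p:V\to\mathbb{R}^d$ and $u,v\in V$ put $d_{uv}=\frac{p(u)-p(v)}{\|p(u)-p(v)\|}$ if $p(u)\ne p(v)$ and $d_{uv}=0$ otherwise. Let $R(G,p)\in\mathbb{R}^{d|V|\times|E|}$ be the matrix whose columns are the vectors $(1_u-1_v)\otimes d_{uv}$, one for each edge $\{u,v\}\in E$, where $\{1_u\}_{u\in V}$ is the standard basis of $\mathbb{R}^{|V|}$ and $\otimes$ is the Kronecker product, and let $L(G,p)=R(G,p)R(G,p)^{T}$. Writing $\lambda_k(A)$ for the $k$-th smallest eigenvalue (with multiplicity) of a real symmetric matrix $A$, the $d$-dimensional algebraic connectivity of $G$ is, for $|V|\ge d+1$, $$a_d(G)=\sup\left\{\lambda_{\binom{d+1}{2}+1}(L(G,p)) \;:\; p:V\to\mathbb{R}^d\right\}.$$ Let $d\ge 3$ and $n\ge d+1$, and let $K_n$ be the complete graph on $n$ vertices. Then $$a_d(K_n)\ \ge\ \frac12\left\lfloor\frac nd\right\rfloor .$$ -/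

import Mathlib

namespace Rigidity

variable {V : Type*} {d : ℕ}

/-- The unit vector `d_{uv}` pointing from `p v` to `p u`, and `0` if `p u = p v`. -/
noncomputable def direction (p : V → EuclideanSpace ℝ (Fin d)) (u v : V) :
    EuclideanSpace ℝ (Fin d) :=
  open scoped Classical in
  if p u = p v then 0 else ‖p u - p v‖⁻¹ • (p u - p v)

theorem direction_swap (p : V → EuclideanSpace ℝ (Fin d)) (u v : V) :
    direction p v u = -direction p u v := by
  unfold direction
  by_cases h : p u = p v
  · simp [h]
  · rw [if_neg h, if_neg (Ne.symm h), norm_sub_rev, ← smul_neg, neg_sub]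

/-- The vector `(1_u - 1_v) ⊗ d_{uv}`, with coordinates indexed by `V × Fin d`. -/
noncomputable def edgeVector [DecidableEq V] (p : V → EuclideanSpace ℝ (Fin d)) (u v : V) :
    V × Fin d → ℝ :=
  fun x => ((Pi.single u 1 : V → ℝ) x.1 - (Pi.single v 1 : V → ℝ) x.1) * direction p u v x.2

theorem edgeVector_swap [DecidableEq V] (p : V → EuclideanSpace ℝ (Fin d)) (u v : V) :
    edgeVector p u v = edgeVector p v u := by
  funext x
  simp only [edgeVector, direction_swap p u v, PiLp.neg_apply]
  ring

/-- The normalized rigidity matrix `R(G, p)`: its columns are the vectors `(1_u - 1_v) ⊗ d_{uv}`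
for the edges `{u, v}` of `G` (the vector does not depend on the order of `u` and `v`). -/
noncomputable def rigidityMatrix [DecidableEq V] (G : SimpleGraph V)
    (p : V → EuclideanSpace ℝ (Fin d)) : Matrix (V × Fin d) G.edgeSet ℝ :=
  Matrix.of fun x e => Sym2.lift ⟨edgeVector p, edgeVector_swap p⟩ (e : Sym2 V) x

/-- The stiffness matrix `L(G, p) = R(G, p) R(G, p)ᵀ`. -/
noncomputable def stiffnessMatrix [Fintype V] [DecidableEq V] (G : SimpleGraph V)
    [DecidableRel G.Adj] (p : V → EuclideanSpace ℝ (Fin d)) :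
    Matrix (V × Fin d) (V × Fin d) ℝ :=
  rigidityMatrix G p * (rigidityMatrix G p).transpose

theorem stiffnessMatrix_isHermitian [Fintype V] [DecidableEq V] (G : SimpleGraph V)
    [DecidableRel G.Adj] (p : V → EuclideanSpace ℝ (Fin d)) :
    (stiffnessMatrix G p).IsHermitian := by
  have h := Matrix.isHermitian_mul_conjTranspose_self (rigidityMatrix G p)
  rwa [Matrix.conjTranspose_eq_transpose_of_trivial] at h

/-- The `k`-th smallest eigenvalue `λ_k(A)` of a real symmetric matrix, counted with
multiplicity and starting at `k = 1`. Mathlib's `eigenvalues₀` lists the eigenvalues in decreasing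
order, so this is its entry in (zero-based) position `N - k`, where `N` is the size of `A`.
The value is `0` if `k` is not between `1` and `N`. -/
noncomputable def kthSmallestEigenvalue {m : Type*} [Fintype m] [DecidableEq m]
    {A : Matrix m m ℝ} (hA : A.IsHermitian) (k : ℕ) : ℝ :=
  if h : 1 ≤ k ∧ k ≤ Fintype.card m then
    hA.eigenvalues₀ ⟨Fintype.card m - k, by omega⟩
  else 0

/-- The `d`-dimensional algebraic connectivity `a_d(G)`: the supremum, over all maps
`p : V → ℝ^d`, of the `(binom (d+1) 2 + 1)`-th smallest eigenvalue of `L(G, p)`. -/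
noncomputable def algebraicConnectivity (d : ℕ) [Fintype V] [DecidableEq V] (G : SimpleGraph V)
    [DecidableRel G.Adj] : ℝ :=
  ⨆ p : V → EuclideanSpace ℝ (Fin d),
    kthSmallestEigenvalue (stiffnessMatrix_isHermitian G p) ((d + 1).choose 2 + 1)

end Rigidity

open Finset Matrix

namespace Rigidity

/-! Split the vertices into `d` color classes, each of size at least `m = ⌊n/d⌋`. Place class `i`
near the basis vector `e_i`, and separate its points by distinct small shifts along the normal
`(1,…,1)`. As the shifts tend to `0`, edges inside a class point along the normal, and edges between
classes `i` and `j` point along `e_i - e_j`. The limiting quadratic form thus decouples into scalar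
complete or complete bipartite Laplacians, one for each unordered pair `{i, j}` with `i = j`
allowed. Requiring the coordinate for `{i, j}` to have total sum zero over the two classes costs one
linear condition per pair, `binom (d+1) 2` in all: exactly the number of eigenvalues to be skipped.
Under these conditions each Laplacian is bounded below by `m` (`mul_sum_sq_le_sum_sub_sq`), and the
coordinates seen from one vertex retain at least half of its squared norm
(`half_sum_sq_le_sum_frameCoord_sq`). Hence the limiting form is at least `m/2` on the constrained
space (`le_sum_frameCoord_sub_sq`). Courant–Fischer (`le_kthSmallestEigenvalue`) turns this into an
eigenvalue bound, up to an arbitrarily small error from stopping before the limit. -/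

/-! ### Variational bounds for eigenvalues. -/

theorem _root_.Matrix.IsHermitian.eigenvectorBasis_dotProduct {m : Type*} [Fintype m]
    [DecidableEq m] {A : Matrix m m ℝ} (hA : A.IsHermitian) (i j : m) :
    (hA.eigenvectorBasis i : m → ℝ) ⬝ᵥ (hA.eigenvectorBasis j : m → ℝ) =
      if i = j then 1 else 0 := by
  have h := orthonormal_iff_ite.mp hA.eigenvectorBasis.orthonormal j i
  rw [EuclideanSpace.inner_eq_star_dotProduct] at h
  simpa [eq_comm] using h

theorem kthSmallestEigenvalue_succ {m : Type*} [Fintype m] [DecidableEq m] {A : Matrix m m ℝ}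
    (hA : A.IsHermitian) {k : ℕ} (hk : k + 1 ≤ Fintype.card m) :
    kthSmallestEigenvalue hA (k + 1) =
      hA.eigenvalues₀ ⟨Fintype.card m - (k + 1), by omega⟩ := by
  rw [kthSmallestEigenvalue, dif_pos ⟨by omega, hk⟩]

/-- A Courant–Fischer lower bound: a quadratic form bounded below on the kernel of a linear map
of rank at most `k` has its `(k + 1)`-th smallest eigenvalue bounded below. -/
theorem le_kthSmallestEigenvalue {m W : Type*} [Fintype m] [DecidableEq m] [AddCommGroup W]
    [Module ℝ W] [FiniteDimensional ℝ W] {A : Matrix m m ℝ} (hA : A.IsHermitian) {k : ℕ}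
    (hk : k + 1 ≤ Fintype.card m) (φ : (m → ℝ) →ₗ[ℝ] W) (hW : Module.finrank ℝ W ≤ k) {c : ℝ}
    (h : ∀ x, φ x = 0 → c * (x ⬝ᵥ x) ≤ x ⬝ᵥ A *ᵥ x) :
    c ≤ kthSmallestEigenvalue hA (k + 1) := by
  rw [kthSmallestEigenvalue_succ hA hk]
  set μ := hA.eigenvalues₀ ⟨Fintype.card m - (k + 1), by omega⟩ with hμ
  -- This is the equivalence used to define `eigenvalues` from `eigenvalues₀`. The last `k + 1`
  -- positions of the decreasing list hold the `k + 1` smallest eigenvalues, of which `μ` is the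
  -- largest.
  let e : Fin (Fintype.card m) ≃ m := Fintype.equivOfCardEq (Fintype.card_fin _)
  let ι : Fin (k + 1) → m := fun i => e ⟨Fintype.card m - (k + 1) + i, by omega⟩
  have hι : Function.Injective ι := by
    intro i j hij
    have := congrArg Fin.val (e.injective hij)
    ext; simpa using this
  have hev : ∀ i, hA.eigenvalues (ι i) ≤ μ := by
    intro i
    simp only [Matrix.IsHermitian.eigenvalues, ι, e, Equiv.symm_apply_apply]
    apply hA.eigenvalues₀_antitone
    simp [Fin.le_def]
  let b : Fin (k + 1) → m → ℝ := fun i => hA.eigenvectorBasis (ι i)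
  have hb : ∀ i j, b i ⬝ᵥ b j = if i = j then 1 else 0 := by
    intro i j
    simp only [b, hA.eigenvectorBasis_dotProduct, hι.eq_iff]
  let ψ : (Fin (k + 1) → ℝ) →ₗ[ℝ] W := φ ∘ₗ Fintype.linearCombination ℝ b
  -- The span of `k + 1` eigenvectors must meet the kernel of `φ` nontrivially, since the target has
  -- dimension at most `k`.
  have hker : LinearMap.ker ψ ≠ ⊥ := LinearMap.ker_ne_bot_of_finrank_lt (by simp; omega)
  obtain ⟨a, ha, ha0⟩ := Submodule.exists_mem_ne_zero_of_ne_bot hker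
  set x : m → ℝ := ∑ i, a i • b i with hx
  have hφ : φ x = 0 := by
    rwa [LinearMap.mem_ker, LinearMap.comp_apply, Fintype.linearCombination_apply] at ha
  have hAx : A *ᵥ x = ∑ i, (a i * hA.eigenvalues (ι i)) • b i := by
    rw [hx, Matrix.mulVec_sum]
    refine sum_congr rfl fun i _ => ?_
    rw [Matrix.mulVec_smul, hA.mulVec_eigenvectorBasis, smul_smul]
  have hdot : ∀ a' : Fin (k + 1) → ℝ, x ⬝ᵥ ∑ i, a' i • b i = ∑ i, a i * a' i := by
    intro a'
    simp [hx, sum_dotProduct, dotProduct_sum, hb, mul_comm]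
  have h1 := h x hφ
  rw [hAx, hdot, hdot] at h1
  have hpos : 0 < ∑ i, a i * a i := by
    obtain ⟨i, hi⟩ := Function.ne_iff.mp ha0
    exact sum_pos' (fun i _ => mul_self_nonneg _) ⟨i, mem_univ _, mul_self_pos.mpr hi⟩
  have h2 : ∑ i, a i * (a i * hA.eigenvalues (ι i)) ≤ μ * ∑ i, a i * a i := by
    rw [mul_sum]
    refine sum_le_sum fun i _ => ?_
    nlinarith [mul_le_mul_of_nonneg_left (hev i) (mul_self_nonneg (a i))]
  exact le_of_mul_le_mul_right (h1.trans h2) hpos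

theorem kthSmallestEigenvalue_le {m : Type*} [Fintype m] [DecidableEq m] {A : Matrix m m ℝ}
    (hA : A.IsHermitian) {k : ℕ} (hk : k + 1 ≤ Fintype.card m) {C : ℝ}
    (h : ∀ x, x ⬝ᵥ A *ᵥ x ≤ C * (x ⬝ᵥ x)) : kthSmallestEigenvalue hA (k + 1) ≤ C := by
  rw [kthSmallestEigenvalue_succ hA hk]
  let e : Fin (Fintype.card m) ≃ m := Fintype.equivOfCardEq (Fintype.card_fin _)
  have h1 := h (hA.eigenvectorBasis (e ⟨Fintype.card m - (k + 1), by omega⟩))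
  rw [hA.mulVec_eigenvectorBasis, dotProduct_smul, hA.eigenvectorBasis_dotProduct] at h1
  simpa [Matrix.IsHermitian.eigenvalues, e] using h1

/-! ### The stiffness form of the complete graph. -/

/-- The vector in `ℝ^d` attached to the vertex `u` by an element of `ℝ^(V × Fin d)`. -/
noncomputable def vertexPart {V : Type*} {d : ℕ} (x : V × Fin d → ℝ) (u : V) :
    EuclideanSpace ℝ (Fin d) :=
  WithLp.toLp 2 fun k => x (u, k)

theorem dotProduct_self_eq_sum_norm_sq {V : Type*} [Fintype V] {d : ℕ} (x : V × Fin d → ℝ) :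
    x ⬝ᵥ x = ∑ u, ‖vertexPart x u‖ ^ 2 := by
  simp only [dotProduct, Fintype.sum_prod_type, EuclideanSpace.real_norm_sq_eq, vertexPart, ← sq]

theorem edgeVector_dotProduct {V : Type*} [Fintype V] [DecidableEq V] {d : ℕ}
    (p : V → EuclideanSpace ℝ (Fin d)) (u v : V) (x : V × Fin d → ℝ) :
    edgeVector p u v ⬝ᵥ x =
      inner ℝ (direction p u v) (vertexPart x u - vertexPart x v) := by
  simp only [dotProduct, edgeVector, Fintype.sum_prod_type, PiLp.inner_apply, vertexPart]
  rw [sum_comm]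
  refine sum_congr rfl fun k _ => ?_
  simp only [sub_mul, sum_sub_distrib, Pi.single_apply, ite_mul, one_mul, zero_mul, sum_ite_eq',
    mem_univ, if_true]
  simp
  ring

/-- The ordered double sum counts every edge twice, and its diagonal terms vanish; it decouples by
color classes more easily than a sum over edges. -/
theorem dotProduct_stiffnessMatrix_mulVec {n d : ℕ} (p : Fin n → EuclideanSpace ℝ (Fin d))
    (x : Fin n × Fin d → ℝ) :
    x ⬝ᵥ stiffnessMatrix ⊤ p *ᵥ x = 1 / 2 * ∑ u, ∑ v,
      inner ℝ (direction p u v) (vertexPart x u - vertexPart x v) ^ 2 := by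
  have hsq : x ⬝ᵥ stiffnessMatrix ⊤ p *ᵥ x = ∑ e : (⊤ : SimpleGraph (Fin n)).edgeSet,
      (Sym2.lift ⟨edgeVector p, edgeVector_swap p⟩ (e : Sym2 (Fin n)) ⬝ᵥ x) ^ 2 := by
    rw [stiffnessMatrix, ← mulVec_mulVec, dotProduct_mulVec, ← mulVec_transpose]
    simp only [dotProduct, sq]
    rfl
  let f : Sym2 (Fin n) → ℝ := fun e =>
    (Sym2.lift ⟨edgeVector p, edgeVector_swap p⟩ e ⬝ᵥ x) ^ 2
  let g : Fin n × Fin n → ℝ := fun q =>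
    inner ℝ (direction p q.1 q.2) (vertexPart x q.1 - vertexPart x q.2) ^ 2
  have hfg : ∀ u v, f s(u, v) = g (u, v) := fun u v => by
    simp only [f, g, Sym2.lift_mk, edgeVector_dotProduct]
  have hg : ∀ u v, g (u, v) = g (v, u) := fun u v => by
    rw [← hfg, ← hfg, Sym2.eq_swap]
  have h1 : ∑ e : (⊤ : SimpleGraph (Fin n)).edgeSet, f e =
      ∑ e ∈ (univ : Finset (Fin n)).sym2 with ¬ e.IsDiag, f e := by
    refine (Finset.sum_subtype _ (fun e => ?_) f).symm
    simp
  have h2 : ∑ e ∈ (univ : Finset (Fin n)).offDiag with e.1 < e.2, f s(e.1, e.2) =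
      ∑ u, ∑ v, if u < v then g (u, v) else 0 := by
    have : (univ : Finset (Fin n)).offDiag.filter (fun e => e.1 < e.2) =
        univ.filter (fun e => e.1 < e.2) := by
      ext e
      simpa using fun h : e.1 < e.2 => h.ne
    rw [this, sum_filter, Fintype.sum_prod_type]
    simp only [hfg]
  have h3 : ∑ u, ∑ v, g (u, v) = 2 * ∑ u, ∑ v, if u < v then g (u, v) else 0 := by
    rw [two_mul]
    nth_rewrite 2 [sum_comm]
    simp only [← sum_add_distrib]
    refine sum_congr rfl fun u _ => sum_congr rfl fun v _ => ?_
    rcases lt_trichotomy u v with h | rfl | h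
    · simp [h, h.not_gt]
    · simp [g]
    · simp [h, h.not_gt, hg u v]
  rw [hsq]
  change ∑ e : (⊤ : SimpleGraph (Fin n)).edgeSet, f e = 1 / 2 * ∑ u, ∑ v, g (u, v)
  rw [h1, sum_sym2_filter_not_isDiag, h2, h3]
  ring


/-! ### The limiting form of a balanced coloring. -/

/-- In the expansion the cross term is `-2 (∑_A f)(∑_B f)`, which equals `2 (∑_B f)² ≥ 0` because
the two sums are opposite. Disjointness plays no role, so `A = B` is covered. -/
theorem mul_sum_sq_le_sum_sub_sq {α : Type*} (A B : Finset α) (f : α → ℝ) {m : ℝ}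
    (hA : m ≤ A.card) (hB : m ≤ B.card) (h : ∑ u ∈ A, f u + ∑ u ∈ B, f u = 0) :
    m * (∑ u ∈ A, f u ^ 2 + ∑ u ∈ B, f u ^ 2) ≤ ∑ u ∈ A, ∑ v ∈ B, (f u - f v) ^ 2 := by
  have h1 : ∑ u ∈ A, ∑ v ∈ B, (f u - f v) ^ 2 = B.card * ∑ u ∈ A, f u ^ 2 +
      A.card * ∑ u ∈ B, f u ^ 2 - 2 * ((∑ u ∈ A, f u) * ∑ u ∈ B, f u) := by
    rw [sum_mul_sum, mul_sum, mul_sum (s := A)]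
    simp only [sub_sq, sum_add_distrib, sum_sub_distrib, sum_const, nsmul_eq_mul, mul_sum,
      mul_assoc]
    ring
  rw [h1, eq_neg_of_add_eq_zero_left h]
  nlinarith [sq_nonneg (∑ u ∈ B, f u), mul_le_mul_of_nonneg_right hB
    (sum_nonneg fun u (_ : u ∈ A) => sq_nonneg (f u)), mul_le_mul_of_nonneg_right hA
    (sum_nonneg fun u (_ : u ∈ B) => sq_nonneg (f u))]

/-- The coordinates of a vector of `ℝ^d` along the (unnormalized) edges at the `i`-th vertex of the
standard simplex, the `i`-th one being the coordinate along the normal of the simplex. -/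
noncomputable def frameCoord {d : ℕ} (i j : Fin d) : (Fin d → ℝ) →ₗ[ℝ] ℝ :=
  if i = j then ∑ k, LinearMap.proj (R := ℝ) (φ := fun _ : Fin d => ℝ) k
  else LinearMap.proj (R := ℝ) (φ := fun _ : Fin d => ℝ) i - LinearMap.proj j

/-- The inverse squared length of the vector defining `frameCoord i j`. -/
noncomputable def frameWeight {d : ℕ} (i j : Fin d) : ℝ := if i = j then 1 / d else 1 / 2

theorem frameCoord_self {d : ℕ} (i : Fin d) (y : Fin d → ℝ) : frameCoord i i y = ∑ k, y k := by
  simp [frameCoord]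

theorem frameCoord_of_ne {d : ℕ} {i j : Fin d} (h : i ≠ j) (y : Fin d → ℝ) :
    frameCoord i j y = y i - y j := by
  simp [frameCoord, h]

theorem frameCoord_swap {d : ℕ} {i j : Fin d} (h : i ≠ j) (y : Fin d → ℝ) :
    frameCoord j i y = -frameCoord i j y := by
  rw [frameCoord_of_ne h, frameCoord_of_ne h.symm, neg_sub]

theorem frameCoord_sq_swap {d : ℕ} (i j : Fin d) (y : Fin d → ℝ) :
    frameCoord j i y ^ 2 = frameCoord i j y ^ 2 := by
  by_cases h : i = j
  · rw [h]
  · rw [frameCoord_swap h, neg_sq]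

theorem frameWeight_swap {d : ℕ} (i j : Fin d) :
    (frameWeight j i : ℝ) = frameWeight i j := by
  simp only [frameWeight, eq_comm]

theorem frameWeight_nonneg {d : ℕ} (i j : Fin d) : 0 ≤ frameWeight i j := by
  unfold frameWeight; split_ifs <;> positivity

/-- Expanding the right side produces `1/2 ∑ y_k²` plus a quadratic form in `y_i` and `∑ y_k`, which
is a sum of two squares. -/
theorem half_sum_sq_le_sum_frameCoord_sq {d : ℕ} (i : Fin d) (y : Fin d → ℝ) :
    1 / 2 * ∑ k, y k ^ 2 ≤ ∑ j, frameWeight i j * frameCoord i j y ^ 2 := by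
  have hd : (0 : ℝ) < d := by exact_mod_cast i.pos
  have h1 : ∀ j, frameWeight i j * frameCoord i j y ^ 2 =
      (if i = j then 1 / (d : ℝ) * (∑ k, y k) ^ 2 else 0) + 1 / 2 * (y i - y j) ^ 2 := by
    intro j
    by_cases h : i = j
    · subst h; simp [frameWeight, frameCoord_self]
    · simp [frameWeight, frameCoord_of_ne h, h]
  have h2 : ∑ j, (y i - y j) ^ 2 = d * y i ^ 2 - 2 * y i * (∑ k, y k) + ∑ k, y k ^ 2 := by
    simp [sub_sq, sum_add_distrib, sum_sub_distrib, mul_sum]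
  simp only [h1, sum_add_distrib, sum_ite_eq, mem_univ, if_true, ← mul_sum, h2]
  have h3 : 1 / (d : ℝ) * (∑ k, y k) ^ 2 + 1 / 2 * (d * y i ^ 2 - 2 * y i * (∑ k, y k)) =
      1 / (d : ℝ) * ((∑ k, y k - 1 / 2 * d * y i) ^ 2 + 1 / 4 * (d * y i) ^ 2) := by
    field_simp
    ring
  have h4 : 0 ≤ 1 / (d : ℝ) * ((∑ k, y k - 1 / 2 * d * y i) ^ 2 + 1 / 4 * (d * y i) ^ 2) := by
    positivity
  linarith

/-- The sums of `frameCoord i j` over the `i`-th and `j`-th classes of a coloring `c` of the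
vertices, for all unordered pairs `{i, j}`. -/
noncomputable def balanceMap {V : Type*} [Fintype V] {d : ℕ} (c : V → Fin d) :
    (V × Fin d → ℝ) →ₗ[ℝ] (Sym2 (Fin d) → ℝ) :=
  LinearMap.pi fun s =>
    ∑ u with c u = s.inf, frameCoord s.inf s.sup ∘ₗ LinearMap.funLeft ℝ ℝ (fun k => (u, k)) +
    ∑ u with c u = s.sup, frameCoord s.inf s.sup ∘ₗ LinearMap.funLeft ℝ ℝ (fun k => (u, k))

/-- `balanceMap` records each pair in sorted order only; swapping `i` and `j` negates the
coordinate, so the condition holds in both orders. -/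
theorem sum_frameCoord_eq_zero {V : Type*} [Fintype V] {d : ℕ} {c : V → Fin d}
    {x : V × Fin d → ℝ} (hx : balanceMap c x = 0) (i j : Fin d) :
    ∑ u with c u = i, frameCoord i j (fun k => x (u, k)) +
      ∑ u with c u = j, frameCoord i j (fun k => x (u, k)) = 0 := by
  have key : ∀ i j : Fin d, i ≤ j → ∑ u with c u = i, frameCoord i j (fun k => x (u, k)) +
      ∑ u with c u = j, frameCoord i j (fun k => x (u, k)) = 0 := by
    intro i j hij
    have := congrFun hx s(i, j)
    simpa [balanceMap, inf_eq_left.mpr hij, sup_eq_right.mpr hij, LinearMap.funLeft,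
      Function.comp_def] using this
  rcases le_or_gt i j with h | h
  · exact key i j h
  · have := key j i h.le
    simp only [frameCoord_swap h.ne, sum_neg_distrib]
    linarith

/-- On the kernel of `balanceMap`, the limiting stiffness form of a balanced coloring is bounded
below. -/
theorem le_sum_frameCoord_sub_sq {V : Type*} [Fintype V] {d : ℕ} {c : V → Fin d} {m : ℝ}
    (hm : ∀ i, m ≤ (univ.filter fun u => c u = i).card) (hm0 : 0 ≤ m)
    {x : V × Fin d → ℝ} (hx : balanceMap c x = 0) :
    m * ∑ u, ∑ k, x (u, k) ^ 2 ≤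
      ∑ u, ∑ v, frameWeight (c u) (c v) *
        frameCoord (c u) (c v) (fun k => x (u, k) - x (v, k)) ^ 2 := by
  let h : Fin d → Fin d → V → ℝ := fun i j u => frameCoord i j fun k => x (u, k)
  have hsub : ∀ i j u v, frameCoord i j (fun k => x (u, k) - x (v, k)) = h i j u - h i j v :=
    fun i j u v => map_sub (frameCoord i j) (fun k => x (u, k)) (fun k => x (v, k))
  simp only [hsub]
  have h1 : ∑ u, ∑ v, frameWeight (c u) (c v) * (h (c u) (c v) u - h (c u) (c v) v) ^ 2 =
      ∑ i, ∑ j, frameWeight i j *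
        ∑ u with c u = i, ∑ v with c v = j, (h i j u - h i j v) ^ 2 := by
    rw [← sum_fiberwise_of_maps_to (s := univ) (t := univ) (g := c) (fun _ _ => mem_univ _)]
    refine sum_congr rfl fun i _ => ?_
    simp only [mul_sum]
    conv_rhs => rw [sum_comm]
    refine sum_congr rfl fun u hu => ?_
    obtain rfl := (mem_filter.mp hu).2
    rw [← sum_fiberwise_of_maps_to (s := univ) (t := univ) (g := c) (fun _ _ => mem_univ _)]
    refine sum_congr rfl fun j _ => sum_congr rfl fun v hv => ?_
    rw [(mem_filter.mp hv).2]
  have h2 : ∑ i, ∑ j, frameWeight i j *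
      (m * (∑ u with c u = i, h i j u ^ 2 + ∑ u with c u = j, h i j u ^ 2)) ≤
      ∑ i, ∑ j, frameWeight i j *
        ∑ u with c u = i, ∑ v with c v = j, (h i j u - h i j v) ^ 2 :=
    sum_le_sum fun i _ => sum_le_sum fun j _ => mul_le_mul_of_nonneg_left
      (mul_sum_sq_le_sum_sub_sq _ _ _ (hm i) (hm j) (sum_frameCoord_eq_zero hx i j))
      (frameWeight_nonneg i j)
  -- Weights and squared coordinates are symmetric in `i, j`, so both endpoints contribute equally.
  -- The resulting factor `2` cancels the `1/2` of `half_sum_sq_le_sum_frameCoord_sq`.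
  have h3 : ∑ i, ∑ j, frameWeight i j * ∑ u with c u = j, h i j u ^ 2 =
      ∑ i, ∑ j, frameWeight i j * ∑ u with c u = i, h i j u ^ 2 := by
    rw [sum_comm]
    refine sum_congr rfl fun i _ => sum_congr rfl fun j _ => ?_
    simp only [h, frameWeight_swap i j, frameCoord_sq_swap i j]
  have h4 : ∑ i, ∑ j, frameWeight i j * ∑ u with c u = i, h i j u ^ 2 =
      ∑ u, ∑ j, frameWeight (c u) j * h (c u) j u ^ 2 := by
    rw [← sum_fiberwise_of_maps_to (s := univ) (t := univ) (g := c) (fun _ _ => mem_univ _)]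
    refine sum_congr rfl fun i _ => ?_
    simp only [mul_sum]
    rw [sum_comm]
    refine sum_congr rfl fun u hu => ?_
    rw [(mem_filter.mp hu).2]
  have h5 : ∑ i, ∑ j, frameWeight i j *
      (m * (∑ u with c u = i, h i j u ^ 2 + ∑ u with c u = j, h i j u ^ 2)) =
      m * (2 * ∑ u, ∑ j, frameWeight (c u) j * h (c u) j u ^ 2) := by
    have h6 : ∀ w a b : ℝ, w * (m * (a + b)) = m * (w * a) + m * (w * b) := fun w a b => by ring
    simp only [h6, sum_add_distrib, ← mul_sum]
    rw [h3, h4]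
    ring
  rw [h1]
  refine le_trans ?_ h2
  rw [h5]
  refine mul_le_mul_of_nonneg_left ?_ hm0
  rw [mul_sum]
  refine sum_le_sum fun u _ => ?_
  have := half_sum_sq_le_sum_frameCoord_sq (c u) (fun k => x (u, k))
  linarith

/-! ### Limits of directions and the perturbation error. -/

theorem norm_direction_le_one {V : Type*} {d : ℕ} (p : V → EuclideanSpace ℝ (Fin d)) (u v : V) :
    ‖direction p u v‖ ≤ 1 := by
  unfold direction
  split_ifs with h
  · simp
  · rw [norm_smul, norm_inv, norm_norm, inv_mul_cancel₀ (norm_ne_zero_iff.mpr (sub_ne_zero.mpr h))]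

theorem direction_eq_smul {V : Type*} {d : ℕ} (p : V → EuclideanSpace ℝ (Fin d)) (u v : V) :
    direction p u v = ‖p u - p v‖⁻¹ • (p u - p v) := by
  unfold direction
  split_ifs with h
  · simp [h]
  · rfl

theorem inner_direction_sq {V : Type*} {d : ℕ} (p : V → EuclideanSpace ℝ (Fin d)) (u v : V)
    (z : EuclideanSpace ℝ (Fin d)) :
    inner ℝ (direction p u v) z ^ 2 = inner ℝ (p u - p v) z ^ 2 / ‖p u - p v‖ ^ 2 := by
  rw [direction_eq_smul, real_inner_smul_left, mul_pow, inv_pow, div_eq_inv_mul]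

/-- A difference of squares factors as `⟪b - a, z⟫ ⟪b + a, z⟫`, with factors at most `δ‖z‖` and
`2‖z‖` in absolute value. -/
theorem inner_sq_le_of_norm_sub_le {E : Type*} [NormedAddCommGroup E] [InnerProductSpace ℝ E]
    {a b : E} {δ : ℝ} (ha : ‖a‖ ≤ 1) (hb : ‖b‖ ≤ 1) (h : ‖a - b‖ ≤ δ) (z : E) :
    inner ℝ b z ^ 2 - 2 * δ * ‖z‖ ^ 2 ≤ inner ℝ a z ^ 2 := by
  have h1 : inner ℝ b z ^ 2 - inner ℝ a z ^ 2 = inner ℝ (b - a) z * inner ℝ (b + a) z := by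
    rw [inner_sub_left, inner_add_left]; ring
  have h2 : |inner ℝ (b - a) z| ≤ δ * ‖z‖ :=
    (abs_real_inner_le_norm _ _).trans (by rw [norm_sub_rev]; gcongr)
  have h3 : |inner ℝ (b + a) z| ≤ 2 * ‖z‖ :=
    (abs_real_inner_le_norm _ _).trans (by gcongr; linarith [norm_add_le b a])
  have h4 := (le_abs_self _).trans ((abs_mul _ _).le.trans
    (mul_le_mul h2 h3 (abs_nonneg _) ((abs_nonneg _).trans h2)))
  nlinarith

/-- The vertices of the standard simplex, indexed by a coloring. -/
noncomputable def simplexMap {V : Type*} {d : ℕ} (c : V → Fin d) (u : V) :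
    EuclideanSpace ℝ (Fin d) :=
  EuclideanSpace.single (c u) 1

/-- Points on the line normal to the standard simplex. -/
noncomputable def normalMap {V : Type*} (d : ℕ) (t : V → ℝ) (u : V) :
    EuclideanSpace ℝ (Fin d) :=
  WithLp.toLp 2 fun _ => t u

/-- The limit as `ε → 0` of the directions of `simplexMap c + ε • normalMap d t`. -/
noncomputable def limitDirection {V : Type*} {d : ℕ} (c : V → Fin d) (t : V → ℝ) (u v : V) :
    EuclideanSpace ℝ (Fin d) :=
  if c u = c v then direction (normalMap d t) u v else direction (simplexMap c) u v

theorem norm_limitDirection_le_one {V : Type*} {d : ℕ} (c : V → Fin d) (t : V → ℝ) (u v : V) :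
    ‖limitDirection c t u v‖ ≤ 1 := by
  unfold limitDirection
  split_ifs <;> exact norm_direction_le_one _ _ _

/-- Squaring removes the sign of `t u - t v`, and normalizing removes its size, so only the colors
matter. For `u = v` the left side is `0` while the right side need not be. -/
theorem inner_limitDirection_sq {V : Type*} {d : ℕ} (c : V → Fin d) {t : V → ℝ}
    (ht : Function.Injective t) {u v : V} (huv : u ≠ v) (z : EuclideanSpace ℝ (Fin d)) :
    inner ℝ (limitDirection c t u v) z ^ 2 =
      frameWeight (c u) (c v) * frameCoord (c u) (c v) (fun k => z k) ^ 2 := by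
  unfold limitDirection
  split_ifs with h
  · have hd : (d : ℝ) ≠ 0 := by exact_mod_cast (c u).pos.ne'
    have hs : t u - t v ≠ 0 := sub_ne_zero.mpr (ht.ne huv)
    have h1 : inner ℝ (normalMap d t u - normalMap d t v) z = (t u - t v) * ∑ k, z k := by
      simp [PiLp.inner_apply, normalMap, mul_comm, sum_mul]
    have h2 : ‖normalMap d t u - normalMap d t v‖ ^ 2 = d * (t u - t v) ^ 2 := by
      simp [EuclideanSpace.real_norm_sq_eq, normalMap]
    rw [inner_direction_sq, h1, h2, ← h, frameCoord_self, frameWeight, if_pos rfl]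
    field_simp
  · have h1 : inner ℝ (simplexMap c u - simplexMap c v) z = z (c u) - z (c v) := by
      simp [simplexMap, inner_sub_left, EuclideanSpace.inner_single_left]
    have h2 : ‖simplexMap c u - simplexMap c v‖ ^ 2 = 2 := by
      rw [norm_sub_sq_real]
      simp [simplexMap, EuclideanSpace.inner_single_left, h]
      norm_num
    rw [inner_direction_sq, h1, h2, frameCoord_of_ne h, frameWeight, if_neg h]
    ring

open Filter Topology in
-- Within a class the simplex parts cancel, and by scale invariance the direction is constant for `ε
-- > 0`. Between classes the difference has a nonzero limit, near which normalization is continuous.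
theorem tendsto_direction {V : Type*} {d : ℕ} (c : V → Fin d) (t : V → ℝ) (u v : V) :
    Tendsto (fun ε : ℝ => direction (fun w => simplexMap c w + ε • normalMap d t w) u v)
      (𝓝[>] 0) (𝓝 (limitDirection c t u v)) := by
  have hdiff : ∀ ε : ℝ, simplexMap c u + ε • normalMap d t u - (simplexMap c v +
      ε • normalMap d t v) = (simplexMap c u - simplexMap c v) +
      ε • (normalMap d t u - normalMap d t v) := fun ε => by
    rw [smul_sub]; abel
  unfold limitDirection
  split_ifs with h
  · refine tendsto_const_nhds.congr' ?_
    filter_upwards [self_mem_nhdsWithin] with ε (hε : 0 < ε)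
    rw [direction_eq_smul, direction_eq_smul, hdiff]
    have : simplexMap c u - simplexMap c v = 0 := by simp [simplexMap, h]
    rw [this, zero_add, norm_smul, Real.norm_of_nonneg hε.le, smul_smul, _root_.mul_inv_rev, mul_assoc,
      inv_mul_cancel₀ hε.ne', mul_one]
  · simp only [direction_eq_smul, hdiff]
    have hne : simplexMap c u - simplexMap c v ≠ 0 := by
      intro h0
      have := congrArg (fun z : EuclideanSpace ℝ (Fin d) => z (c u)) h0
      simp [simplexMap, h] at this
    have hcont : Tendsto (fun ε : ℝ => (simplexMap c u - simplexMap c v) +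
        ε • (normalMap d t u - normalMap d t v)) (𝓝[>] 0)
        (𝓝 (simplexMap c u - simplexMap c v)) := by
      have : Continuous (fun ε : ℝ => (simplexMap c u - simplexMap c v) +
        ε • (normalMap d t u - normalMap d t v)) := by fun_prop
      have := this.tendsto 0
      rw [zero_smul, add_zero] at this
      exact this.mono_left nhdsWithin_le_nhds
    exact (hcont.norm.inv₀ (norm_ne_zero_iff.mpr hne)).smul hcont

open Filter Topology in
theorem exists_norm_direction_sub_limitDirection_le {V : Type*} [Finite V] {d : ℕ}
    (c : V → Fin d) (t : V → ℝ) {δ : ℝ} (hδ : 0 < δ) :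
    ∃ p : V → EuclideanSpace ℝ (Fin d),
      ∀ u v, ‖direction p u v - limitDirection c t u v‖ ≤ δ := by
  have : ∀ᶠ ε : ℝ in 𝓝[>] 0, ∀ u v,
      ‖direction (fun w => simplexMap c w + ε • normalMap d t w) u v -
        limitDirection c t u v‖ ≤ δ := by
    refine eventually_all.mpr fun u => eventually_all.mpr fun v => ?_
    filter_upwards [(tendsto_direction c t u v).eventually (Metric.closedBall_mem_nhds _ hδ)]
      with ε hε
    simpa [dist_eq_norm] using hε
  obtain ⟨ε, hε⟩ := this.exists
  exact ⟨_, hε⟩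

theorem sum_norm_vertexPart_sub_sq_le {V : Type*} [Fintype V] {d : ℕ} (x : V × Fin d → ℝ) :
    ∑ u, ∑ v, ‖vertexPart x u - vertexPart x v‖ ^ 2 ≤ 4 * Fintype.card V * (x ⬝ᵥ x) := by
  have h : ∀ u v, ‖vertexPart x u - vertexPart x v‖ ^ 2 ≤
      2 * ‖vertexPart x u‖ ^ 2 + 2 * ‖vertexPart x v‖ ^ 2 := fun u v => by
    have := parallelogram_law_with_norm ℝ (vertexPart x u) (vertexPart x v)
    nlinarith [sq_nonneg ‖vertexPart x u + vertexPart x v‖]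
  refine (sum_le_sum fun u _ => sum_le_sum fun v _ => h u v).trans (le_of_eq ?_)
  rw [dotProduct_self_eq_sum_norm_sq]
  simp only [sum_add_distrib, ← mul_sum, sum_const, card_univ, nsmul_eq_mul]
  ring

theorem dotProduct_stiffnessMatrix_mulVec_le {n d : ℕ} (p : Fin n → EuclideanSpace ℝ (Fin d))
    (x : Fin n × Fin d → ℝ) :
    x ⬝ᵥ stiffnessMatrix ⊤ p *ᵥ x ≤ 2 * n * (x ⬝ᵥ x) := by
  rw [dotProduct_stiffnessMatrix_mulVec]
  have h : ∑ u, ∑ v, inner ℝ (direction p u v) (vertexPart x u - vertexPart x v) ^ 2 ≤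
      ∑ u, ∑ v, ‖vertexPart x u - vertexPart x v‖ ^ 2 := by
    refine sum_le_sum fun u _ => sum_le_sum fun v _ => ?_
    rw [← sq_abs]
    gcongr
    refine (abs_real_inner_le_norm _ _).trans ?_
    exact mul_le_of_le_one_left (norm_nonneg _) (norm_direction_le_one p u v)
  have := sum_norm_vertexPart_sub_sq_le x
  rw [Fintype.card_fin] at this
  linarith

/-- Each ordered pair loses at most `2δ‖x_u - x_v‖²`. These squared norms sum to at most `4n (x ⬝ᵥ
x)`, and the factor `1/2` of the double sum leaves an error of `4nδ`. -/
theorem le_dotProduct_stiffnessMatrix_mulVec {n d : ℕ} {c : Fin n → Fin d} {t : Fin n → ℝ}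
    (ht : Function.Injective t) {m : ℝ} (hm : ∀ i, m ≤ (univ.filter fun u => c u = i).card)
    (hm0 : 0 ≤ m) {p : Fin n → EuclideanSpace ℝ (Fin d)} {δ : ℝ}
    (hp : ∀ u v, ‖direction p u v - limitDirection c t u v‖ ≤ δ)
    {x : Fin n × Fin d → ℝ} (hx : balanceMap c x = 0) (hδ : 0 ≤ δ) :
    (1 / 2 * m - 4 * n * δ) * (x ⬝ᵥ x) ≤ x ⬝ᵥ stiffnessMatrix ⊤ p *ᵥ x := by
  rw [dotProduct_stiffnessMatrix_mulVec]
  have h1 : ∀ u v, frameWeight (c u) (c v) *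
      frameCoord (c u) (c v) (fun k => x (u, k) - x (v, k)) ^ 2 -
        2 * δ * ‖vertexPart x u - vertexPart x v‖ ^ 2 ≤
      inner ℝ (direction p u v) (vertexPart x u - vertexPart x v) ^ 2 := by
    intro u v
    by_cases huv : u = v
    -- The diagonal is treated separately because `inner_limitDirection_sq` requires distinct
    -- vertices; here every term is zero.
    · subst huv
      have : (fun k => x (u, k) - x (u, k)) = 0 := by ext; simp
      rw [this, map_zero]
      simp
    · have := inner_sq_le_of_norm_sub_le (norm_direction_le_one p u v)
        (norm_limitDirection_le_one c t u v) (hp u v) (vertexPart x u - vertexPart x v)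
      rwa [inner_limitDirection_sq c ht huv] at this
  have h2 := sum_le_sum fun u (_ : u ∈ univ) => sum_le_sum fun v (_ : v ∈ univ) => h1 u v
  simp only [sum_sub_distrib, ← mul_sum] at h2
  have h3 := le_sum_frameCoord_sub_sq hm hm0 hx
  have h4 := mul_le_mul_of_nonneg_left (sum_norm_vertexPart_sub_sq_le x) hδ
  rw [Fintype.card_fin] at h4
  have h5 : ∑ u, ∑ k, x (u, k) ^ 2 = x ⬝ᵥ x := by
    simp [dotProduct, Fintype.sum_prod_type, sq]
  rw [h5] at h3
  linarith

/-! ### The balanced coloring and the conclusion. -/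

theorem div_le_card_filter_mod {n d : ℕ} (hd : 0 < d) (i : Fin d) :
    n / d ≤ (univ.filter fun u : Fin n => (⟨u % d, Nat.mod_lt _ hd⟩ : Fin d) = i).card := by
  -- The numbers `i + d * k` with `k < n / d` are distinct vertices of residue `i`.
  have hlt : ∀ k < n / d, i + d * k < n := fun k hk =>
    calc i + d * k < d + d * k := by omega
      _ = d * (k + 1) := by ring
      _ ≤ d * (n / d) := Nat.mul_le_mul_left _ hk
      _ ≤ n := Nat.mul_div_le n d
  rw [← Fintype.card_fin (n / d), ← card_univ]
  refine card_le_card_of_injOn (fun k => ⟨i + d * k, hlt k k.2⟩) (fun k _ => ?_) ?_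
  · simp [Fin.ext_iff, Nat.mod_eq_of_lt i.2]
  · intro a _ b _ hab
    have : d * (a : ℕ) = d * b := by simpa using hab
    exact Fin.ext (Nat.eq_of_mul_eq_mul_left hd this)

theorem choose_succ_lt_mul {d n : ℕ} (hd : 0 < d) (hn : d + 1 ≤ n) :
    (d + 1).choose 2 + 1 ≤ n * d := by
  have h1 : (d + 1).choose 2 * 2 = (d + 1) * d := by
    rw [Nat.choose_two_right, Nat.add_sub_cancel]
    exact Nat.div_mul_cancel (by simpa [mul_comm] using (Nat.even_mul_succ_self d).two_dvd)
  have h2 : (d + 1) * d ≤ n * d := Nat.mul_le_mul_right d hn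
  have h3 : 2 * 1 ≤ (d + 1) * d := Nat.mul_le_mul (by omega) hd
  omega

/-- A real `⨆` over an unbounded family is `0` by convention, so boundedness is needed before one
`p` can bound the supremum from below. -/
theorem bddAbove_range_kthSmallestEigenvalue {n d k : ℕ} (hk : k + 1 ≤ n * d) :
    BddAbove (Set.range fun p : Fin n → EuclideanSpace ℝ (Fin d) =>
      kthSmallestEigenvalue (stiffnessMatrix_isHermitian ⊤ p) (k + 1)) := by
  refine ⟨2 * n, ?_⟩
  rintro _ ⟨p, rfl⟩
  exact kthSmallestEigenvalue_le _ (by simpa using hk) (dotProduct_stiffnessMatrix_mulVec_le p)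

end Rigidity

open Rigidity in
theorem corollary1p4 (d n : ℕ) (hd : 3 ≤ d) (hn : d + 1 ≤ n) :
    (1 / 2 : ℝ) * (⌊(n : ℝ) / (d : ℝ)⌋ : ℝ) ≤
      Rigidity.algebraicConnectivity d (⊤ : SimpleGraph (Fin n)) := by
  have hd0 : 0 < d := by omega
  have hk := choose_succ_lt_mul hd0 hn
  have hfloor : (⌊(n : ℝ) / (d : ℝ)⌋ : ℝ) = ((n / d : ℕ) : ℝ) := by
    rw [← Nat.floor_div_eq_div (K := ℝ) n d, ← natCast_floor_eq_intCast_floor (by positivity)]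
  rw [hfloor]
  -- The limiting directions are only approximated by an actual `p`, so a loss `η` is allowed; `δ =
  -- η / (4n)` below makes the error `4nδ` equal to `η`.
  refine le_of_forall_pos_sub_le fun η hη => ?_
  have hn0 : (0 : ℝ) < n := by exact_mod_cast (by omega : 0 < n)
  let c : Fin n → Fin d := fun u => ⟨u % d, Nat.mod_lt _ hd0⟩
  have ht : Function.Injective fun u : Fin n => ((u : ℕ) : ℝ) :=
    Nat.cast_injective.comp Fin.val_injective
  have hδ : 0 < η / (4 * n) := by positivity
  obtain ⟨p, hp⟩ := exists_norm_direction_sub_limitDirection_le c (fun u => ((u : ℕ) : ℝ)) hδ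
  refine le_trans ?_ (le_ciSup (bddAbove_range_kthSmallestEigenvalue hk) p)
  -- The target of `balanceMap c` has dimension `card (Sym2 (Fin d)) = binom (d+1) 2`, which matches
  -- the eigenvalue index exactly.
  refine le_kthSmallestEigenvalue _ (by simpa using hk) (balanceMap c)
    (by simp [Sym2.card]) fun x hx => ?_
  have := le_dotProduct_stiffnessMatrix_mulVec ht
    (fun i => Nat.cast_le.mpr (div_le_card_filter_mod hd0 i)) (Nat.cast_nonneg _) hp hx hδ.le
  rwa [mul_div_cancel₀ η (by positivity)] at this
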